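/- Let $0<s<1$, let $I_i=(a_i,b_i)$, $i=1,\dots,k$, be finitely many pairwise disjoint nonempty open subintervals of $(-1,1)$, and let $\Omega=\bigcup_{i=1}^k I_i$. Let $c_s=\frac{4^s\Gamma(\frac12+s)}{\sqrt\pi\,|\Gamma(-s)|}$, let $H^s(\mathbb R)$ be the space of $u\in L^2(\mathbb R)$ with $\iint_{\mathbb R\times\mathbb R}\frac{|u(x)-u(y)|^2}{|x-y|^{1+2s}}\,dx\,dy<\infty$, and let $H^s_0(\Omega)=\{u\in H^s(\mathbb R): u=0 \text{ a.e. on } \mathbb R\setminus\Omega\}$, regarded as a subspace of $L^2(\Omega)$ (real or complex scalars). For $u,v\in H^s_0(\Omega)$ put $$\mathcal E_{res}[u,v]=\frac{c_s}{2}\int_\Omega\int_\Omega\frac{\overline{(u(x)-u(y))}\,(v(x)-v(y))}{|x-y|^{1+2s}}\,dx\,dy+\int_\Omega\kappa(x)\,\overline{u(x)}\,v(x)\,dx,\qquad \kappa(x)=c_s\int_{\mathbb R\setminus\Omega}\frac{dy}{|x-y|^{1+2s}}.$$ The restricted fractional Laplacian $(-\Delta)^s_{res}$ on $\Omega$ (that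 is, $(-\Delta)^s$ with Dirichlet condition on $\mathbb R\setminus\Omega$) is the operator in $L^2(\Omega)$ acting in the weak sense: $u$ belongs to its domain and $(-\Delta)^s_{res}u=f$ if and only if $u\in H^s_0(\Omega)$, $f\in L^2(\Omega)$ and $\mathcal E_{res}[u,v]=\langle f,v\rangle_{L^2(\Omega)}$ for all $v\in H^s_0(\Omega)$, where $\langle\cdot,\cdot\rangle_{L^2(\Omega)}$ is conjugate-linear in its first argument. Then $(-\Delta)^s_{res}$ is a well-defined (single-valued) linear operator; it is densely defined, closed, symmetric, and a bijection of its domain onto $L^2(\Omega)$; and it is self-adjoint in $L^2(\Omega)$. Moreover, for all real numbers $V_1,\dots,V_k$ and every $\epsilon>0$, the operator $u\mapsto(-\Delta)^s_{res}u+\epsilon V u$, where $V=V_i$ on $I_i$, with the same domain as $(-\Delta)^s_{res}$, is closed and self-adjoint. -/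

import Mathlib

open MeasureTheory TopologicalSpace
open scoped ENNReal ComplexConjugate

noncomputable section

namespace FracLap

variable {𝕜 : Type*} [RCLike 𝕜]

/-- The normalising constant `c_s = 4^s Γ(1/2 + s) / (√π |Γ(-s)|)` of the one-dimensional
fractional Laplacian `(-Δ)^s`. -/
def fracConst (s : ℝ) : ℝ :=
  4 ^ s * Real.Gamma (1 / 2 + s) / (Real.sqrt Real.pi * |Real.Gamma (-s)|)

/-- The squared Gagliardo seminorm `[u]²_{H^s(ℝ)} = ∬ |u(x) - u(y)|² / |x - y|^(1 + 2s) dx dy`,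
with values in `[0, ∞]`. -/
def gagliardoSq (s : ℝ) (u : ℝ → 𝕜) : ℝ≥0∞ :=
  ∫⁻ p : ℝ × ℝ, ENNReal.ofReal (‖u p.1 - u p.2‖ ^ 2 / |p.1 - p.2| ^ (1 + 2 * s))

/-- Membership in the fractional Sobolev space `H^s(ℝ)`. -/
def MemHs (s : ℝ) (u : ℝ → 𝕜) : Prop :=
  MemLp u 2 volume ∧ gagliardoSq s u < ∞

/-- The Hilbert space `L²(Ω)`. -/
abbrev L2 (𝕜 : Type*) [RCLike 𝕜] (Ω : Opens ℝ) : Type _ :=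
  Lp 𝕜 2 (volume.restrict (Ω : Set ℝ))

/-- The extension of `u ∈ L²(Ω)` by zero to all of `ℝ`. -/
def zeroExt {Ω : Opens ℝ} (u : L2 𝕜 Ω) : ℝ → 𝕜 :=
  (Ω : Set ℝ).indicator u

/-- The killing term `κ(x) = c_s ∫_{ℝ ∖ Ω} |x - y|^(-(1 + 2s)) dy`. -/
def kappa (s : ℝ) (Ω : Opens ℝ) (x : ℝ) : ℝ :=
  fracConst s * ∫ y in (Ω : Set ℝ)ᶜ, 1 / |x - y| ^ (1 + 2 * s)

/-- The form of the restricted fractional Laplacian,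
`ℰ_res[u, v] = (c_s / 2) ∬_{Ω × Ω} conj (u(x) - u(y)) (v(x) - v(y)) / |x - y|^(1 + 2s) dx dy
  + ∫_Ω κ(x) conj (u(x)) v(x) dx`
(conjugate-linear in the first variable; the conjugation disappears for real scalars). -/
def energyRes (s : ℝ) (Ω : Opens ℝ) (u v : ℝ → 𝕜) : 𝕜 :=
  ((fracConst s / 2 : ℝ) : 𝕜) *
      (∫ p in (Ω : Set ℝ) ×ˢ (Ω : Set ℝ),
        conj (u p.1 - u p.2) * (v p.1 - v p.2) / ((|p.1 - p.2| ^ (1 + 2 * s) : ℝ) : 𝕜))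
    + ∫ x in (Ω : Set ℝ), ((kappa s Ω x : ℝ) : 𝕜) * conj (u x) * v x

/-! ### Elementary facts: `H^s_0(Ω)` is a linear space and the form is sesquilinear on it -/

theorem zeroExt_zero {Ω : Opens ℝ} : zeroExt (0 : L2 𝕜 Ω) =ᵐ[volume] 0 := by
  have h := (ae_restrict_iff' Ω.isOpen.measurableSet).1
    (Lp.coeFn_zero 𝕜 2 (volume.restrict (Ω : Set ℝ)))
  filter_upwards [h] with x hx
  by_cases hxΩ : x ∈ (Ω : Set ℝ)
  · rw [zeroExt, Set.indicator_of_mem hxΩ, hx hxΩ]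
  · simp [zeroExt, hxΩ]

theorem zeroExt_add {Ω : Opens ℝ} (u v : L2 𝕜 Ω) :
    zeroExt (u + v) =ᵐ[volume] zeroExt u + zeroExt v := by
  have h := (ae_restrict_iff' Ω.isOpen.measurableSet).1 (Lp.coeFn_add u v)
  filter_upwards [h] with x hx
  by_cases hxΩ : x ∈ (Ω : Set ℝ)
  · simp only [zeroExt, Pi.add_apply, Set.indicator_of_mem hxΩ]
    exact hx hxΩ
  · simp [zeroExt, hxΩ]

theorem zeroExt_smul {Ω : Opens ℝ} (c : 𝕜) (u : L2 𝕜 Ω) :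
    zeroExt (c • u) =ᵐ[volume] c • zeroExt u := by
  have h := (ae_restrict_iff' Ω.isOpen.measurableSet).1 (Lp.coeFn_smul c u)
  filter_upwards [h] with x hx
  by_cases hxΩ : x ∈ (Ω : Set ℝ)
  · simp [zeroExt, hxΩ, hx hxΩ]
  · simp [zeroExt, hxΩ]

theorem memLp_zeroExt {Ω : Opens ℝ} (u : L2 𝕜 Ω) : MemLp (zeroExt u) 2 volume :=
  (memLp_indicator_iff_restrict Ω.isOpen.measurableSet).2 (Lp.memLp u)

theorem ae_fst {P : ℝ → Prop} (h : ∀ᵐ x, P x) : ∀ᵐ p : ℝ × ℝ, P p.1 :=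
  Measure.quasiMeasurePreserving_fst.ae h

theorem ae_snd {P : ℝ → Prop} (h : ∀ᵐ x, P x) : ∀ᵐ p : ℝ × ℝ, P p.2 :=
  Measure.quasiMeasurePreserving_snd.ae h

theorem gagliardoSq_congr {s : ℝ} {u v : ℝ → 𝕜} (h : u =ᵐ[volume] v) :
    gagliardoSq s u = gagliardoSq s v := by
  refine lintegral_congr_ae ?_
  filter_upwards [ae_fst h, ae_snd h] with p h1 h2
  rw [h1, h2]

theorem energyRes_congr {s : ℝ} {Ω : Opens ℝ} {u u' : ℝ → 𝕜} (h : u =ᵐ[volume] u')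
    (v : ℝ → 𝕜) : energyRes s Ω u v = energyRes s Ω u' v := by
  unfold energyRes
  congr 1
  · congr 1
    refine integral_congr_ae (ae_restrict_of_ae ?_)
    filter_upwards [ae_fst h, ae_snd h] with p h1 h2
    rw [h1, h2]
  · refine integral_congr_ae (ae_restrict_of_ae ?_)
    filter_upwards [h] with p h1
    rw [h1]

theorem aesm_diff {u : ℝ → 𝕜} (hu : AEStronglyMeasurable u volume) :
    AEStronglyMeasurable (fun p : ℝ × ℝ => u p.1 - u p.2) volume :=
  (hu.comp_quasiMeasurePreserving Measure.quasiMeasurePreserving_fst).sub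
    (hu.comp_quasiMeasurePreserving Measure.quasiMeasurePreserving_snd)

theorem measurable_weight (s : ℝ) :
    Measurable (fun p : ℝ × ℝ => |p.1 - p.2| ^ (1 + 2 * s)) := by
  have h : Measurable (fun p : ℝ × ℝ => |p.1 - p.2|) :=
    (continuous_abs.comp (continuous_fst.sub continuous_snd)).measurable
  exact h.pow_const _

theorem weight_nonneg (s : ℝ) (p : ℝ × ℝ) : 0 ≤ |p.1 - p.2| ^ (1 + 2 * s) :=
  Real.rpow_nonneg (abs_nonneg _) _

theorem memHs_iff {s : ℝ} {u : ℝ → 𝕜} (hu : MemLp u 2 volume) :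
    MemHs s u ↔
      Integrable (fun p : ℝ × ℝ => ‖u p.1 - u p.2‖ ^ 2 / |p.1 - p.2| ^ (1 + 2 * s)) := by
  have hm : AEStronglyMeasurable
      (fun p : ℝ × ℝ => ‖u p.1 - u p.2‖ ^ 2 / |p.1 - p.2| ^ (1 + 2 * s)) volume :=
    (((aesm_diff hu.1).norm.aemeasurable.pow_const 2).div
      (measurable_weight s).aemeasurable).aestronglyMeasurable
  rw [MemHs, and_iff_right hu, Integrable, and_iff_right hm, gagliardoSq,
    hasFiniteIntegral_iff_ofReal]
  exact .of_forall fun p => div_nonneg (sq_nonneg _) (weight_nonneg s p)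

theorem MemHs.congr {s : ℝ} {u v : ℝ → 𝕜} (hu : MemHs s u) (h : u =ᵐ[volume] v) :
    MemHs s v :=
  ⟨(memLp_congr_ae h).1 hu.1, by rw [← gagliardoSq_congr h]; exact hu.2⟩

theorem MemHs.zero {s : ℝ} : MemHs s (0 : ℝ → 𝕜) :=
  ⟨MemLp.zero, by simp [gagliardoSq]⟩

theorem MemHs.add {s : ℝ} {u v : ℝ → 𝕜} (hu : MemHs s u) (hv : MemHs s v) :
    MemHs s (u + v) := by
  have hs := hu.1.add hv.1
  have iu := (memHs_iff hu.1).1 hu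
  have iv := (memHs_iff hv.1).1 hv
  refine (memHs_iff hs).2 (((iu.const_mul 2).add (iv.const_mul 2)).mono' ?_ ?_)
  · exact (((aesm_diff hs.1).norm.aemeasurable.pow_const 2).div
      (measurable_weight s).aemeasurable).aestronglyMeasurable
  · refine .of_forall fun p => ?_
    have hw := weight_nonneg s p
    rw [Real.norm_of_nonneg (div_nonneg (sq_nonneg _) hw)]
    simp only [Pi.add_apply]
    rw [mul_div_assoc', mul_div_assoc', ← add_div]
    refine div_le_div_of_nonneg_right ?_ hw
    have h1 : ‖u p.1 + v p.1 - (u p.2 + v p.2)‖ ≤ ‖u p.1 - u p.2‖ + ‖v p.1 - v p.2‖ := by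
      rw [add_sub_add_comm]; exact norm_add_le _ _
    nlinarith [norm_nonneg (u p.1 + v p.1 - (u p.2 + v p.2)),
      sq_nonneg (‖u p.1 - u p.2‖ - ‖v p.1 - v p.2‖)]

theorem MemHs.smul {s : ℝ} {u : ℝ → 𝕜} (c : 𝕜) (hu : MemHs s u) : MemHs s (c • u) := by
  have iu := (memHs_iff hu.1).1 hu
  refine (memHs_iff (hu.1.const_smul c)).2 ((iu.const_mul (‖c‖ ^ 2)).congr ?_)
  refine .of_forall fun p => ?_
  simp only [Pi.smul_apply, smul_eq_mul, ← mul_sub, norm_mul, mul_pow, mul_div_assoc]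

/-- The space `H^s_0(Ω)` of all `u ∈ H^s(ℝ)` that vanish (almost everywhere) off `Ω`, seen as a
subspace of `L²(Ω)` through extension by zero. -/
def Hs0 (𝕜 : Type*) [RCLike 𝕜] (s : ℝ) (Ω : Opens ℝ) : Submodule 𝕜 (L2 𝕜 Ω) where
  carrier := {u | MemHs s (zeroExt u)}
  zero_mem' := MemHs.zero.congr zeroExt_zero.symm
  add_mem' {u v} hu hv := (MemHs.add hu hv).congr (zeroExt_add u v).symm
  smul_mem' c u hu := (MemHs.smul c hu).congr (zeroExt_smul c u).symm

theorem integrable_form {s : ℝ} {u v : ℝ → 𝕜} (hu : MemHs s u) (hv : MemHs s v) :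
    Integrable (fun p : ℝ × ℝ => conj (u p.1 - u p.2) * (v p.1 - v p.2) /
      ((|p.1 - p.2| ^ (1 + 2 * s) : ℝ) : 𝕜)) := by
  have iu := (memHs_iff hu.1).1 hu
  have iv := (memHs_iff hv.1).1 hv
  refine (iu.add iv).mono' ?_ (.of_forall fun p => ?_)
  · have h1 := RCLike.continuous_conj.comp_aestronglyMeasurable (aesm_diff hu.1.1)
    have h3 : AEMeasurable
        (fun p : ℝ × ℝ => ((|p.1 - p.2| ^ (1 + 2 * s) : ℝ) : 𝕜)) volume :=
      (RCLike.measurable_ofReal.comp (measurable_weight s)).aemeasurable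
    exact ((h1.mul (aesm_diff hv.1.1)).aemeasurable.div h3).aestronglyMeasurable
  · have hw := weight_nonneg s p
    simp only [Pi.add_apply, norm_div, norm_mul, RCLike.norm_conj, RCLike.norm_ofReal,
      abs_of_nonneg hw]
    rw [← add_div]
    refine div_le_div_of_nonneg_right ?_ hw
    nlinarith [sq_nonneg (‖u p.1 - u p.2‖ - ‖v p.1 - v p.2‖), norm_nonneg (u p.1 - u p.2),
      norm_nonneg (v p.1 - v p.2), mul_nonneg (norm_nonneg (u p.1 - u p.2))
        (norm_nonneg (v p.1 - v p.2))]

theorem aesm_kappa (s : ℝ) (Ω : Opens ℝ) (μ : Measure ℝ) :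
    AEStronglyMeasurable (kappa s Ω) μ := by
  have h : StronglyMeasurable (fun p : ℝ × ℝ => 1 / |p.1 - p.2| ^ (1 + 2 * s)) :=
    (measurable_const.div (measurable_weight s)).stronglyMeasurable
  have h2 : StronglyMeasurable
      (fun x : ℝ => ∫ y in (Ω : Set ℝ)ᶜ, 1 / |x - y| ^ (1 + 2 * s)) :=
    h.integral_prod_right
  exact (h2.const_mul _).aestronglyMeasurable

theorem integrable_kappa_sq {s : ℝ} {Ω : Opens ℝ} {u : ℝ → 𝕜} (hu : MemHs s u)
    (h0 : ∀ x ∉ Ω, u x = 0) :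
    Integrable (fun x => kappa s Ω x * ‖u x‖ ^ 2) (volume.restrict (Ω : Set ℝ)) := by
  have iu := (memHs_iff hu.1).1 hu
  have hΩ := Ω.isOpen.measurableSet
  have i1 : Integrable (fun p : ℝ × ℝ => ‖u p.1 - u p.2‖ ^ 2 / |p.1 - p.2| ^ (1 + 2 * s))
      ((volume.restrict (Ω : Set ℝ)).prod (volume.restrict (Ω : Set ℝ)ᶜ)) := by
    rw [Measure.prod_restrict]
    exact iu.integrableOn
  refine (i1.integral_prod_left.const_mul (fracConst s)).congr ?_
  filter_upwards [ae_restrict_mem hΩ] with x hx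
  rw [kappa, mul_assoc, ← integral_mul_const]
  congr 1
  refine setIntegral_congr_fun hΩ.compl fun y hy => ?_
  simp [h0 y hy, div_eq_mul_inv, mul_comm]

theorem integrable_kappa {s : ℝ} {Ω : Opens ℝ} {u v : ℝ → 𝕜} (hu : MemHs s u)
    (hv : MemHs s v) (hu0 : ∀ x ∉ Ω, u x = 0) (hv0 : ∀ x ∉ Ω, v x = 0) :
    Integrable (fun x => ((kappa s Ω x : ℝ) : 𝕜) * conj (u x) * v x)
      (volume.restrict (Ω : Set ℝ)) := by
  have i1 := (integrable_kappa_sq hu hu0).norm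
  have i2 := (integrable_kappa_sq hv hv0).norm
  refine (i1.add i2).mono' ?_ (.of_forall fun x => ?_)
  · have h1 := RCLike.continuous_conj.comp_aestronglyMeasurable
      (hu.1.1.mono_measure (Measure.restrict_le_self (s := (Ω : Set ℝ))))
    exact ((RCLike.continuous_ofReal.comp_aestronglyMeasurable (aesm_kappa s Ω _)).mul h1).mul
      (hv.1.1.mono_measure Measure.restrict_le_self)
  · simp only [Pi.add_apply, norm_mul, norm_pow, RCLike.norm_conj,
      RCLike.norm_ofReal, Real.norm_eq_abs, abs_norm, mul_assoc]
    rw [← mul_add]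
    refine mul_le_mul_of_nonneg_left ?_ (abs_nonneg _)
    nlinarith [sq_nonneg (‖u x‖ - ‖v x‖), norm_nonneg (u x), norm_nonneg (v x),
      mul_nonneg (norm_nonneg (u x)) (norm_nonneg (v x))]

theorem zeroExt_of_notMem {Ω : Opens ℝ} (u : L2 𝕜 Ω) : ∀ x ∉ Ω, zeroExt u x = 0 :=
  fun _ hx => Set.indicator_of_notMem hx _

theorem energyRes_add_left {s : ℝ} {Ω : Opens ℝ} {u u' v : L2 𝕜 Ω} (hu : u ∈ Hs0 𝕜 s Ω)
    (hu' : u' ∈ Hs0 𝕜 s Ω) (hv : v ∈ Hs0 𝕜 s Ω) :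
    energyRes s Ω (zeroExt (u + u')) (zeroExt v) =
      energyRes s Ω (zeroExt u) (zeroExt v) + energyRes s Ω (zeroExt u') (zeroExt v) := by
  rw [energyRes_congr (zeroExt_add u u')]
  have a1 := (integrable_form hu hv).integrableOn (s := (Ω : Set ℝ) ×ˢ (Ω : Set ℝ))
  have a2 := (integrable_form hu' hv).integrableOn (s := (Ω : Set ℝ) ×ˢ (Ω : Set ℝ))
  have b1 := integrable_kappa hu hv (zeroExt_of_notMem u) (zeroExt_of_notMem v)
  have b2 := integrable_kappa hu' hv (zeroExt_of_notMem u') (zeroExt_of_notMem v)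
  unfold energyRes
  rw [add_add_add_comm, ← mul_add, ← integral_add a1 a2, ← integral_add b1 b2]
  congr 2
  · congr 1
    funext p
    simp only [Pi.add_apply, map_sub, map_add]
    ring
  · funext x
    simp only [Pi.add_apply, map_add]
    ring

theorem energyRes_smul_left {s : ℝ} {Ω : Opens ℝ} (c : 𝕜) (u v : L2 𝕜 Ω) :
    energyRes s Ω (zeroExt (c • u)) (zeroExt v) =
      conj c * energyRes s Ω (zeroExt u) (zeroExt v) := by
  rw [energyRes_congr (zeroExt_smul c u)]
  unfold energyRes
  rw [mul_add, mul_left_comm (conj c), ← integral_const_mul (conj c),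
    ← integral_const_mul (conj c)]
  congr 2
  · congr 1
    funext p
    simp only [Pi.smul_apply, smul_eq_mul, map_sub, map_mul]
    ring
  · funext x
    simp only [Pi.smul_apply, smul_eq_mul, map_mul]
    ring

/-! ### The operators -/

/-- `u ∈ H^s_0(Ω)` is a weak solution of `(-Δ)^s_res u = f` in `Ω`, for `f ∈ L²(Ω)`:
`ℰ_res[u, v] = ⟨f, v⟩_{L²(Ω)}` for every `v ∈ H^s_0(Ω)`. -/
def IsWeakSolution (s : ℝ) {Ω : Opens ℝ} (u f : L2 𝕜 Ω) : Prop :=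
  u ∈ Hs0 𝕜 s Ω ∧
    ∀ v ∈ Hs0 𝕜 s Ω, energyRes s Ω (zeroExt u) (zeroExt v) = inner 𝕜 f v

/-- All pairs `(u, f)` such that `(-Δ)^s_res u = f` in the weak sense. -/
def weakGraph (𝕜 : Type*) [RCLike 𝕜] (s : ℝ) (Ω : Opens ℝ) :
    Submodule 𝕜 (L2 𝕜 Ω × L2 𝕜 Ω) where
  carrier := {q | IsWeakSolution s q.1 q.2}
  zero_mem' := by
    refine ⟨(Hs0 𝕜 s Ω).zero_mem, fun v _ => ?_⟩
    have h := energyRes_smul_left (s := s) (0 : 𝕜) (0 : L2 𝕜 Ω) v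
    simpa using h
  add_mem' {q r} hq hr := by
    refine ⟨(Hs0 𝕜 s Ω).add_mem hq.1 hr.1, fun v hv => ?_⟩
    rw [Prod.fst_add, Prod.snd_add, energyRes_add_left hq.1 hr.1 hv, hq.2 v hv, hr.2 v hv,
      inner_add_left]
  smul_mem' c q hq := by
    refine ⟨(Hs0 𝕜 s Ω).smul_mem c hq.1, fun v hv => ?_⟩
    rw [Prod.smul_fst, Prod.smul_snd, energyRes_smul_left, hq.2 v hv, inner_smul_left]

/-- The restricted fractional Laplacian `(-Δ)^s_res` on `Ω` as an unbounded operator in `L²(Ω)`,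
acting in the weak sense: its domain consists of the `u ∈ H^s_0(Ω)` for which
`(-Δ)^s_res u = f` holds weakly for some `f ∈ L²(Ω)`, and it maps such a `u` to `f`. -/
def restrictedFracLaplacian (𝕜 : Type*) [RCLike 𝕜] (s : ℝ) (Ω : Opens ℝ) :
    L2 𝕜 Ω →ₗ.[𝕜] L2 𝕜 Ω :=
  (weakGraph 𝕜 s Ω).toLinearPMap

/-- The open set `Ω = ⋃ i, (a i, b i)`. -/
def wells {k : ℕ} (a b : Fin k → ℝ) : Opens ℝ :=
  ⟨⋃ i, Set.Ioo (a i) (b i), isOpen_iUnion fun _ => isOpen_Ioo⟩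

/-- The step function with value `V i` on `(a i, b i)` (for pairwise disjoint intervals), and
`0` off their union. -/
def stepPotential (𝕜 : Type*) [RCLike 𝕜] {k : ℕ} (a b V : Fin k → ℝ) (x : ℝ) : 𝕜 :=
  ∑ i, (Set.Ioo (a i) (b i)).indicator (fun _ => ((V i : ℝ) : 𝕜)) x

theorem memLp_stepPotential {k : ℕ} (a b V : Fin k → ℝ) (μ : Measure ℝ) :
    MemLp (stepPotential 𝕜 a b V) ∞ μ :=
  memLp_finsetSum _ fun i _ => (memLp_top_const ((V i : ℝ) : 𝕜)).indicator measurableSet_Ioo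

/-- Multiplication by the step function with values `V i`, as a bounded operator on `L²(Ω)`. -/
def potentialOp (𝕜 : Type*) [RCLike 𝕜] {k : ℕ} (a b V : Fin k → ℝ) :
    L2 𝕜 (wells a b) →L[𝕜] L2 𝕜 (wells a b) :=
  (ContinuousLinearMap.mul 𝕜 𝕜).holderL _ ∞ 2 2
    (memLp_stepPotential (𝕜 := 𝕜) a b V (volume.restrict (wells a b : Set ℝ))).toLp

/-- The perturbed operator `(-Δ)^s_res + ε V` with `V = V i` on `(a i, b i)`, on the domain of
`(-Δ)^s_res`. -/
def perturbedFracLaplacian (𝕜 : Type*) [RCLike 𝕜] (s : ℝ) {k : ℕ} (a b V : Fin k → ℝ)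
    (ε : ℝ) : L2 𝕜 (wells a b) →ₗ.[𝕜] L2 𝕜 (wells a b) :=
  ((ε : 𝕜) • (potentialOp 𝕜 a b V : L2 𝕜 (wells a b) →ₗ[𝕜] L2 𝕜 (wells a b))) +ᵥ
    restrictedFracLaplacian 𝕜 s (wells a b)

end FracLap

end

/-! The weak problem is inverted first, and self-adjointness is read off the inverse. Functions in
H^s_0(Ω) vanish off Ω, so the killing term is what Ω × Ωᶜ and Ωᶜ × Ω contribute to the Gagliardo
pairing, and ℰ_res[u, v] = ⟨Tu, Tv⟩ in L²(ℝ²), where T is the weighted difference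
(`inner_energyMap`). This T is densely defined (`dense_Hs0`), closed (`energyMap_closed`) and,
because Ω is bounded, bounded below (`norm_sq_le_energyMap`).

Hence T has a closed range R and a bounded inverse L : R → L²(Ω). That ⟨Tu, Tv⟩ = ⟨f, v⟩ for all v
means Tu = L*f, that is, u = L L*f (`exists_symmetric_inverse_of_closed_coercive`). The solution
operator S = L L* is bounded, symmetric and injective, so the weak graph is single-valued and its
operator S⁻¹ is a self-adjoint bijection (`isSelfAdjoint_of_graph_iff`). Multiplication by the real
bounded function εV is a bounded symmetric perturbation, which preserves self-adjointness;
closedness follows from self-adjointness. -/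

open Filter Topology

/-! ### Abstract criteria for self-adjointness -/

namespace LinearPMap

variable {𝕜 H : Type*} [RCLike 𝕜] [NormedAddCommGroup H] [InnerProductSpace 𝕜 H]
  [CompleteSpace H]

/-- A symmetric densely defined operator whose adjoint has no larger domain is self-adjoint. -/
theorem isSelfAdjoint_of_isFormalAdjoint {A : H →ₗ.[𝕜] H} (hd : Dense (A.domain : Set H))
    (hA : A.IsFormalAdjoint A) (h : A.adjoint.domain ≤ A.domain) : IsSelfAdjoint A := by
  have hle := hA.le_adjoint hd
  exact isSelfAdjoint_def.2 (eq_of_le_of_domain_eq hle (le_antisymm hle.1 h)).symm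

/-- Self-adjointness is stable under bounded symmetric perturbations. -/
theorem _root_.IsSelfAdjoint.vadd_continuousLinearMap {A : H →ₗ.[𝕜] H} (hA : IsSelfAdjoint A)
    {B : H →L[𝕜] H} (hB : (B : H →ₗ[𝕜] H).IsSymmetric) :
    IsSelfAdjoint ((B : H →ₗ[𝕜] H) +ᵥ A) := by
  have hd := hA.dense_domain
  have hAA : A.IsFormalAdjoint A := by
    have h := adjoint_isFormalAdjoint hd
    rwa [isSelfAdjoint_def.1 hA] at h
  refine isSelfAdjoint_of_isFormalAdjoint hd (fun x y => ?_) fun y hy => ?_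
  · rw [vadd_apply, vadd_apply, inner_add_left, inner_add_right]
    exact congrArg₂ _ (hB _ _) (hAA x y)
  · change y ∈ A.domain
    rw [← isSelfAdjoint_def.1 hA, mem_adjoint_domain_iff]
    rw [mem_adjoint_domain_iff] at hy
    -- Subtracting the bounded functional x ↦ ⟨y, Bx⟩ leaves x ↦ ⟨y, Ax⟩ continuous, which places y
    -- in the domain of A* = A.
    have hB' : Continuous ((innerSL 𝕜 y).comp (B.comp A.domain.subtypeL)) :=
      ContinuousLinearMap.continuous _
    refine (hy.sub hB').congr fun x => Eq.symm ?_
    change inner 𝕜 y (A x) = inner 𝕜 y (B x + A x) - inner 𝕜 y (B x)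
    rw [inner_add_right, add_sub_cancel_left]

/-- The inverse of an injective symmetric bounded operator is a self-adjoint bijection. -/
theorem isSelfAdjoint_of_graph_iff {A : H →ₗ.[𝕜] H} {S : H →L[𝕜] H}
    (hS : (S : H →ₗ[𝕜] H).IsSymmetric) (hinj : Function.Injective S)
    (h : ∀ u f, (u, f) ∈ A.graph ↔ u = S f) :
    Function.Bijective A ∧ A.IsFormalAdjoint A ∧ IsSelfAdjoint A := by
  have hSA : ∀ x : A.domain, S (A x) = x := fun x => ((h _ _).1 (mem_graph A x)).symm
  have hAS : ∀ f, ∃ x : A.domain, (x : H) = S f ∧ A x = f := fun f =>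
    (mem_graph_iff A).1 ((h _ f).2 rfl)
  have hsymm : A.IsFormalAdjoint A := fun x y => by
    have h1 : inner 𝕜 (S (A x)) (A y) = inner 𝕜 (A x) (S (A y)) := hS _ _
    rw [hSA, hSA] at h1
    exact h1.symm
  -- The domain contains the range of S. If g is orthogonal to it, then ⟨Sg, Sg⟩ = ⟨SSg, g⟩ = 0, so
  -- g = 0 by injectivity.
  have hd : Dense (A.domain : Set H) := by
    rw [Submodule.dense_iff_topologicalClosure_eq_top,
      Submodule.topologicalClosure_eq_top_iff, Submodule.eq_bot_iff]
    intro g hg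
    refine hinj (Eq.trans ?_ S.map_zero.symm)
    rw [← inner_self_eq_zero (𝕜 := 𝕜)]
    obtain ⟨x, hx, -⟩ := hAS (S g)
    rw [show inner 𝕜 (S g) (S g) = inner 𝕜 (S (S g)) g from (hS _ _).symm, ← hx]
    exact hg x x.2
  refine ⟨⟨fun x y hxy => ?_, fun f => ?_⟩, hsymm,
    isSelfAdjoint_of_isFormalAdjoint hd hsymm fun y hy => ?_⟩
  · rw [Subtype.ext_iff, ← hSA x, ← hSA y, hxy]
  · obtain ⟨x, -, hx⟩ := hAS f
    exact ⟨x, hx⟩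
  -- Writing f = A(Sf) gives ⟨y, f⟩ = ⟨A*y, Sf⟩ = ⟨S A*y, f⟩, so y lies in the range of S.
  · have hy' : y = S (A.adjoint ⟨y, hy⟩) := by
      refine ext_inner_right 𝕜 fun f => ?_
      obtain ⟨x, hx, hxf⟩ := hAS f
      rw [show inner 𝕜 (S (A.adjoint ⟨y, hy⟩)) f = inner 𝕜 (A.adjoint ⟨y, hy⟩) (S f)
        from hS _ _, ← hx, adjoint_isFormalAdjoint hd ⟨y, hy⟩ x, hxf]
    obtain ⟨x, hx, -⟩ := hAS (A.adjoint ⟨y, hy⟩)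
    rw [hy', ← hx]
    exact x.2

end LinearPMap

/-! ### Representation of closed coercive forms -/

/-- A densely defined closed coercive form `⟨T u, T v⟩` is represented by the inverse of an
injective symmetric bounded operator. -/
theorem exists_symmetric_inverse_of_closed_coercive {𝕜 H K : Type*} [RCLike 𝕜]
    [NormedAddCommGroup H] [InnerProductSpace 𝕜 H] [CompleteSpace H]
    [NormedAddCommGroup K] [InnerProductSpace 𝕜 K] [CompleteSpace K]
    {D : Submodule 𝕜 H} (hD : Dense (D : Set H)) (T : D →ₗ[𝕜] K) {C : ℝ}
    (hC : ∀ u : D, ‖u‖ ≤ C * ‖T u‖)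
    (hT : ∀ (u : ℕ → D) (x : H) (w : K), Tendsto (fun n => (u n : H)) atTop (𝓝 x) →
      Tendsto (fun n => T (u n)) atTop (𝓝 w) → ∃ hx : x ∈ D, T ⟨x, hx⟩ = w) :
    ∃ S : H →L[𝕜] H, (S : H →ₗ[𝕜] H).IsSymmetric ∧ Function.Injective S ∧
      ∀ u f, u = S f ↔ ∃ hu : u ∈ D, ∀ v : D, inner 𝕜 (T ⟨u, hu⟩) (T v) = inner 𝕜 f (v : H) := by
  have hinj : Function.Injective T := by
    refine (injective_iff_map_eq_zero T).2 fun u hu => ?_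
    have := hC u
    rwa [hu, norm_zero, mul_zero, norm_le_zero_iff] at this
  set R := LinearMap.range T
  set e : D ≃ₗ[𝕜] R := LinearEquiv.ofInjective T hinj
  have he : ∀ u, ((e u : R) : K) = T u := fun u => rfl
  -- L is the inverse of T on its range; coercivity is exactly its boundedness.
  set L : R →L[𝕜] H := (D.subtype ∘ₗ (e.symm : R →ₗ[𝕜] D)).mkContinuous C fun r => by
    have := hC (e.symm r)
    rwa [← he, e.apply_symm_apply] at this
  have hL : ∀ u : D, L (e u) = u := fun u => by
    change ((e.symm (e u) : D) : H) = u
    rw [e.symm_apply_apply]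
  -- L turns a convergent sequence T(uₙ) into a Cauchy sequence uₙ in H, and closedness of T
  -- identifies the limit. Completeness of R is what provides the adjoint of L.
  have hR : IsClosed (R : Set K) := by
    refine isClosed_of_closure_subset fun w hw => ?_
    obtain ⟨r, hr, hrw⟩ := mem_closure_iff_seq_limit.1 hw
    choose u hu using hr
    have hcu : CauchySeq fun n => L ⟨r n, ⟨u n, hu n⟩⟩ := by
      refine L.uniformContinuous.comp_cauchySeq
        (u := fun n => (⟨r n, ⟨u n, hu n⟩⟩ : R)) ?_
      exact ((isUniformInducing_val (R : Set K)).cauchy_map_iff).1 hrw.cauchySeq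
    obtain ⟨x, hx⟩ := cauchySeq_tendsto_of_complete hcu
    have hLu : ∀ n, L ⟨r n, ⟨u n, hu n⟩⟩ = u n := fun n => by
      rw [← hL (u n)]
      congr 1
      exact Subtype.ext (hu n).symm
    simp only [hLu] at hx
    obtain ⟨hxD, hxw⟩ := hT u x w hx (by simpa only [hu] using hrw)
    exact ⟨_, hxw⟩
  have : CompleteSpace R := hR.completeSpace_coe
  have hLinj : Function.Injective L := fun r r' h => e.symm.injective (Subtype.ext h)
  -- The kernel of L* is orthogonal to the range of L, which is the dense subspace D.
  have hadj : Function.Injective (ContinuousLinearMap.adjoint L) := by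
    refine (injective_iff_map_eq_zero _).2 fun f hf => ?_
    refine hD.eq_zero_of_inner_left 𝕜 fun v hv => ?_
    have h := ContinuousLinearMap.adjoint_inner_left L (e ⟨v, hv⟩) f
    rw [hf, inner_zero_left, hL] at h
    exact h.symm
  refine ⟨L ∘L ContinuousLinearMap.adjoint L, fun f g => ?_, hLinj.comp hadj, fun u f => ?_⟩
  · change inner 𝕜 (L _) g = inner 𝕜 f (L _)
    exact (ContinuousLinearMap.adjoint_inner_right L _ _).symm.trans
      (ContinuousLinearMap.adjoint_inner_left L _ _)
  · constructor
    · rintro rfl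
      have hu : ((e.symm (ContinuousLinearMap.adjoint L f) : D) : H) =
        (L ∘L ContinuousLinearMap.adjoint L) f := rfl
      refine ⟨hu ▸ Subtype.property _, fun v => ?_⟩
      change inner 𝕜 (T (e.symm (ContinuousLinearMap.adjoint L f))) (T v) = _
      rw [← he, e.apply_symm_apply, ← hL v]
      exact ContinuousLinearMap.adjoint_inner_left L (e v) f
    · rintro ⟨hu, h⟩
      have : e ⟨u, hu⟩ = ContinuousLinearMap.adjoint L f := by
        refine ext_inner_right 𝕜 fun r => ?_
        obtain ⟨v, rfl⟩ := e.surjective r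
        rw [ContinuousLinearMap.adjoint_inner_left, hL]
        exact h v
      rw [ContinuousLinearMap.comp_apply, ← this, hL]

/-! ### The energy form as an inner product in L²(ℝ²) -/

namespace FracLap

variable {𝕜 : Type*} [RCLike 𝕜]

theorem fracConst_pos {s : ℝ} (hs0 : 0 < s) (hs1 : s < 1) : 0 < fracConst s := by
  have h1 : 0 < Real.Gamma (1 / 2 + s) := Real.Gamma_pos_of_pos (by linarith)
  have h2 : Real.Gamma (-s) ≠ 0 := by
    -- `Real.Gamma` vanishes only at the poles 0, -1, -2, ..., where its value is the default 0; 0 <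
    -- s < 1 keeps -s away from them.
    refine Real.Gamma_ne_zero fun m hm => ?_
    have hm' : s = m := by linarith
    rw [hm'] at hs0 hs1
    norm_cast at hs0 hs1
    omega
  unfold fracConst
  have := abs_pos.2 h2
  positivity

/-- The weighted difference quotient whose `L²(ℝ²)` pairings give the form `ℰ_res`. -/
noncomputable def weightedDiff (s : ℝ) (u : ℝ → 𝕜) (p : ℝ × ℝ) : 𝕜 :=
  ((Real.sqrt (fracConst s / 2 / |p.1 - p.2| ^ (1 + 2 * s)) : ℝ) : 𝕜) * (u p.1 - u p.2)

theorem weightedDiff_congr {s : ℝ} {u v : ℝ → 𝕜} (h : u =ᵐ[volume] v) :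
    weightedDiff s u =ᵐ[volume] weightedDiff s v := by
  filter_upwards [ae_fst h, ae_snd h] with p h1 h2
  rw [weightedDiff, weightedDiff, h1, h2]

theorem aesm_weightedDiff {s : ℝ} {u : ℝ → 𝕜} (hu : AEStronglyMeasurable u volume) :
    AEStronglyMeasurable (weightedDiff s u) volume :=
  (RCLike.continuous_ofReal.comp_aestronglyMeasurable
    ((measurable_const.div (measurable_weight s)).sqrt.aestronglyMeasurable)).mul (aesm_diff hu)

theorem norm_weightedDiff_sq {s : ℝ} (hc : 0 ≤ fracConst s) (u : ℝ → 𝕜) (p : ℝ × ℝ) :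
    ‖weightedDiff s u p‖ ^ 2 =
      fracConst s / 2 * (‖u p.1 - u p.2‖ ^ 2 / |p.1 - p.2| ^ (1 + 2 * s)) := by
  rw [weightedDiff, norm_mul, mul_pow, RCLike.norm_ofReal, sq_abs,
    Real.sq_sqrt (div_nonneg (by positivity) (weight_nonneg s p))]
  ring

theorem memHs_iff_memLp_weightedDiff {s : ℝ} (hc : 0 < fracConst s) {u : ℝ → 𝕜}
    (hu : MemLp u 2 volume) : MemHs s u ↔ MemLp (weightedDiff s u) 2 volume := by
  rw [memHs_iff hu, memLp_two_iff_integrable_sq_norm (aesm_weightedDiff hu.1)]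
  simp only [norm_weightedDiff_sq hc.le]
  exact (integrable_const_mul_iff (IsUnit.mk0 _ (by positivity)) _).symm

theorem conj_weightedDiff_mul {s : ℝ} (hc : 0 ≤ fracConst s) (u v : ℝ → 𝕜) (p : ℝ × ℝ) :
    conj (weightedDiff s u p) * weightedDiff s v p =
      ((fracConst s / 2 : ℝ) : 𝕜) * (conj (u p.1 - u p.2) * (v p.1 - v p.2) /
        ((|p.1 - p.2| ^ (1 + 2 * s) : ℝ) : 𝕜)) := by
  have h := Real.mul_self_sqrt
    (div_nonneg (show 0 ≤ fracConst s / 2 by positivity) (weight_nonneg s p))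
  have h' := congrArg (RCLike.ofReal (K := 𝕜)) h
  rw [RCLike.ofReal_mul, RCLike.ofReal_div] at h'
  rw [weightedDiff, weightedDiff, map_mul, RCLike.conj_ofReal, mul_mul_mul_comm, h']
  ring

/-- The form is the full Gagliardo pairing over `ℝ × ℝ`: the killing term collects the
contributions of `Ω × Ωᶜ` and `Ωᶜ × Ω`. -/
theorem energyRes_eq_integral {s : ℝ} {Ω : Opens ℝ} {u v : ℝ → 𝕜} (hu : MemHs s u)
    (hv : MemHs s v) (hu0 : ∀ x ∉ Ω, u x = 0) (hv0 : ∀ x ∉ Ω, v x = 0) :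
    energyRes s Ω u v = ((fracConst s / 2 : ℝ) : 𝕜) *
      ∫ p : ℝ × ℝ, conj (u p.1 - u p.2) * (v p.1 - v p.2) /
        ((|p.1 - p.2| ^ (1 + 2 * s) : ℝ) : 𝕜) := by
  have hΩ := Ω.isOpen.measurableSet
  have hF := integrable_form hu hv
  set F : ℝ × ℝ → 𝕜 := fun p => conj (u p.1 - u p.2) * (v p.1 - v p.2) /
    ((|p.1 - p.2| ^ (1 + 2 * s) : ℝ) : 𝕜) with hFdef
  set μ := (volume : Measure ℝ).restrict (Ω : Set ℝ) with hμ
  set ν := (volume : Measure ℝ).restrict (Ω : Set ℝ)ᶜ with hν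
  -- Of the four blocks, Ωᶜ × Ωᶜ contributes nothing and the two mixed ones agree by symmetry; their
  -- sum turns the factor c_s / 2 into the c_s of `kappa`.
  have hsplit : (volume : Measure (ℝ × ℝ)) = (μ.prod μ + ν.prod μ) + (μ.prod ν + ν.prod ν) := by
    rw [← Measure.add_prod, ← Measure.add_prod, ← Measure.prod_add,
      Measure.restrict_add_restrict_compl hΩ, Measure.volume_eq_prod]
  have hF' := hF
  rw [hsplit, integrable_add_measure, integrable_add_measure, integrable_add_measure] at hF'
  obtain ⟨⟨i1, i2⟩, i3, i4⟩ := hF'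
  have e4 : ∫ p, F p ∂(ν.prod ν) = 0 := by
    rw [hν, Measure.prod_restrict]
    refine setIntegral_eq_zero_of_forall_eq_zero fun p hp => ?_
    simp [hFdef, hu0 _ hp.1, hu0 _ hp.2]
  have e2 : ∫ p, F p ∂(ν.prod μ) = ∫ p, F p ∂(μ.prod ν) := by
    rw [← integral_prod_swap]
    refine integral_congr_ae (.of_forall fun p => ?_)
    simp only [hFdef, Prod.fst_swap, Prod.snd_swap]
    rw [← neg_sub (u p.1), ← neg_sub (v p.1), map_neg, neg_mul_neg, abs_sub_comm]
  -- For y outside Ω the numerator is conj (u x) * v x, so only the kernel remains to be integrated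
  -- in y.
  have e3 : ((fracConst s : ℝ) : 𝕜) * ∫ p, F p ∂(μ.prod ν) =
      ∫ x in (Ω : Set ℝ), ((kappa s Ω x : ℝ) : 𝕜) * conj (u x) * v x := by
    rw [integral_prod _ i3, ← integral_const_mul]
    refine setIntegral_congr_fun hΩ fun x hx => ?_
    rw [kappa, RCLike.ofReal_mul, ← integral_ofReal, mul_assoc, mul_assoc,
      ← integral_mul_const]
    congr 1
    refine setIntegral_congr_fun hΩ.compl fun y hy => ?_
    simp only [hFdef, hu0 y hy, hv0 y hy, sub_zero, one_div, RCLike.ofReal_inv]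
    ring
  have e1 : ∫ p, F p = ∫ p, F p ∂(μ.prod μ) + 2 * ∫ p, F p ∂(μ.prod ν) := by
    conv_lhs => rw [hsplit]
    rw [integral_add_measure (i1.add_measure i2) (i3.add_measure i4), integral_add_measure i1 i2,
      integral_add_measure i3 i4, e2, e4]
    ring
  rw [e1, energyRes, ← e3, mul_add]
  congr 1
  · rw [hμ, Measure.prod_restrict, ← Measure.volume_eq_prod]
  · push_cast
    ring

/-- The map `u ↦ weightedDiff s u` from `H^s_0(Ω)` to `L²(ℝ²)`. -/
noncomputable def energyMap (𝕜 : Type*) [RCLike 𝕜] {s : ℝ} (hc : 0 < fracConst s) (Ω : Opens ℝ) :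
    Hs0 𝕜 s Ω →ₗ[𝕜] Lp 𝕜 2 (volume : Measure (ℝ × ℝ)) where
  toFun u := ((memHs_iff_memLp_weightedDiff hc (memLp_zeroExt u.1)).1 u.2).toLp
  map_add' u v := by
    rw [← MemLp.toLp_add]
    refine MemLp.toLp_congr _ _ ((weightedDiff_congr (zeroExt_add u.1 v.1)).trans
      (.of_forall fun p => ?_))
    simp only [weightedDiff, Pi.add_apply]
    ring
  map_smul' c u := by
    rw [RingHom.id_apply, ← MemLp.toLp_const_smul]
    refine MemLp.toLp_congr _ _ ((weightedDiff_congr (zeroExt_smul c u.1)).trans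
      (.of_forall fun p => ?_))
    simp only [weightedDiff, Pi.smul_apply, smul_eq_mul]
    ring

theorem coeFn_energyMap {s : ℝ} (hc : 0 < fracConst s) {Ω : Opens ℝ} (u : Hs0 𝕜 s Ω) :
    energyMap 𝕜 hc Ω u =ᵐ[volume] weightedDiff s (zeroExt u.1) :=
  MemLp.coeFn_toLp ((memHs_iff_memLp_weightedDiff hc (memLp_zeroExt u.1)).1 u.2)

theorem inner_energyMap {s : ℝ} (hc : 0 < fracConst s) {Ω : Opens ℝ} (u v : Hs0 𝕜 s Ω) :
    inner 𝕜 (energyMap 𝕜 hc Ω u) (energyMap 𝕜 hc Ω v) =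
      energyRes s Ω (zeroExt u.1) (zeroExt v.1) := by
  rw [energyRes_eq_integral u.2 v.2 (zeroExt_of_notMem _) (zeroExt_of_notMem _),
    ← integral_const_mul, L2.inner_def]
  refine integral_congr_ae ?_
  filter_upwards [coeFn_energyMap hc u, coeFn_energyMap hc v] with p h1 h2
  rw [h1, h2, RCLike.inner_apply, mul_comm, conj_weightedDiff_mul hc.le]

/-! ### Poincaré inequality -/

theorem norm_sq_L2_eq {α : Type*} [MeasurableSpace α] {μ : Measure α} (f : Lp 𝕜 2 μ) :
    ‖f‖ ^ 2 = ∫ x, ‖f x‖ ^ 2 ∂μ := by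
  have h := congrArg RCLike.re (L2.inner_def (𝕜 := 𝕜) f f)
  rw [inner_self_eq_norm_sq] at h
  rw [h, ← integral_re (L2.integrable_inner f f)]
  exact integral_congr_ae (.of_forall fun x => inner_self_eq_norm_sq (𝕜 := 𝕜) (f x))

/-- Poincaré inequality on subsets of `(-1, 1)`. -/
theorem norm_sq_le_energyMap {s : ℝ} (hs : 0 < s) (hc : 0 < fracConst s) {Ω : Opens ℝ}
    (hΩ1 : (Ω : Set ℝ) ⊆ Set.Ioo (-1) 1) (u : Hs0 𝕜 s Ω) :
    fracConst s / 4 ^ (1 + 2 * s) * ‖u‖ ^ 2 ≤ ‖energyMap 𝕜 hc Ω u‖ ^ 2 := by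
  have hΩ := Ω.isOpen.measurableSet
  set U := zeroExt u.1 with hU
  have hi := (memHs_iff (memLp_zeroExt u.1)).1 u.2
  have hUΩ : Set.EqOn (fun x => ‖u.1 x‖ ^ 2) (fun x => ‖U x‖ ^ 2) (Ω : Set ℝ) := fun x hx => by
    simp only [hU, zeroExt, Set.indicator_of_mem hx]
  have hint : Integrable (fun x => ‖U x‖ ^ 2) (volume.restrict (Ω : Set ℝ)) :=
    ((memLp_two_iff_integrable_sq_norm (memLp_zeroExt u.1).1).1 (memLp_zeroExt u.1)).integrableOn
  have e1 : ‖u‖ ^ 2 = ∫ x in (Ω : Set ℝ), ‖U x‖ ^ 2 := by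
    rw [← setIntegral_congr_fun hΩ hUΩ]
    exact norm_sq_L2_eq u.1
  have e2 : ‖energyMap 𝕜 hc Ω u‖ ^ 2 =
      fracConst s / 2 * ∫ p : ℝ × ℝ, ‖U p.1 - U p.2‖ ^ 2 / |p.1 - p.2| ^ (1 + 2 * s) := by
    rw [norm_sq_L2_eq, ← integral_const_mul]
    refine integral_congr_ae ?_
    filter_upwards [coeFn_energyMap hc u] with p hp
    rw [hp, norm_weightedDiff_sq hc.le]
  -- The energy is bounded below by its part over Ω × (1, 3), where u(y) = 0 and |x - y| ≤ 4. The
  -- length 2 of (1, 3) cancels the 1/2 in c_s / 2.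
  have hprod : ∫ p in (Ω : Set ℝ) ×ˢ Set.Ioo (1 : ℝ) 3, ‖U p.1‖ ^ 2 * (1 / 4 ^ (1 + 2 * s)) =
      (∫ x in (Ω : Set ℝ), ‖U x‖ ^ 2) * (2 / 4 ^ (1 + 2 * s)) := by
    rw [Measure.volume_eq_prod, ← Measure.prod_restrict,
      integral_prod_mul (fun x => ‖U x‖ ^ 2) (fun _ => (1 / 4 ^ (1 + 2 * s) : ℝ))]
    congr 1
    rw [setIntegral_const, Real.volume_real_Ioo, smul_eq_mul]
    norm_num
    ring
  have hle : ∫ p in (Ω : Set ℝ) ×ˢ Set.Ioo (1 : ℝ) 3, ‖U p.1‖ ^ 2 * (1 / 4 ^ (1 + 2 * s)) ≤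
      ∫ p : ℝ × ℝ, ‖U p.1 - U p.2‖ ^ 2 / |p.1 - p.2| ^ (1 + 2 * s) := by
    refine le_trans (setIntegral_mono_on ?_ hi.integrableOn (hΩ.prod measurableSet_Ioo)
      fun p hp => ?_) (setIntegral_le_integral hi
        (.of_forall fun p => div_nonneg (sq_nonneg _) (weight_nonneg s p)))
    · rw [IntegrableOn, Measure.volume_eq_prod, ← Measure.prod_restrict]
      exact hint.mul_prod (integrable_const _)
    · have hx := hΩ1 hp.1
      have hy := hp.2
      have hy' : p.2 ∉ Ω := fun h => not_lt_of_gt (hΩ1 h).2 hy.1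
      have hxy : 0 < |p.1 - p.2| ∧ |p.1 - p.2| ≤ 4 := by
        rw [abs_sub_comm, abs_of_pos (by linarith [hx.2, hy.1])]
        constructor <;> linarith [hx.1, hx.2, hy.1, hy.2]
      rw [hU, zeroExt_of_notMem u.1 _ hy', sub_zero, ← hU, mul_one_div]
      exact div_le_div_of_nonneg_left (sq_nonneg _) (Real.rpow_pos_of_pos hxy.1 _)
        (Real.rpow_le_rpow hxy.1.le hxy.2 (by linarith))
  rw [e1, e2]
  refine le_trans (le_of_eq ?_) (mul_le_mul_of_nonneg_left (hprod.symm.trans_le hle)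
    (by positivity))
  ring

/-! ### Closedness of the form -/

theorem tendsto_ae_zeroExt {Ω : Opens ℝ} {u : ℕ → L2 𝕜 Ω} {x : L2 𝕜 Ω}
    (h : ∀ᵐ t ∂(volume.restrict (Ω : Set ℝ)), Tendsto (fun n => u n t) atTop (𝓝 (x t))) :
    ∀ᵐ t, Tendsto (fun n => zeroExt (u n) t) atTop (𝓝 (zeroExt x t)) := by
  filter_upwards [(ae_restrict_iff' Ω.isOpen.measurableSet).1 h] with t ht
  by_cases htΩ : t ∈ (Ω : Set ℝ)
  · simpa only [zeroExt, Set.indicator_of_mem htΩ] using ht htΩ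
  · simp [zeroExt, htΩ]

/-- Along a subsequence both limits hold almost everywhere. The weighted difference at (x, y)
depends only on the values at x and y, so it passes to the limit pointwise and must equal w; square
integrability of w then puts the limit in H^s_0(Ω). -/
theorem energyMap_closed {s : ℝ} (hc : 0 < fracConst s) {Ω : Opens ℝ} (u : ℕ → Hs0 𝕜 s Ω)
    (x : L2 𝕜 Ω) (w : Lp 𝕜 2 (volume : Measure (ℝ × ℝ)))
    (hu : Tendsto (fun n => (u n : L2 𝕜 Ω)) atTop (𝓝 x))
    (hw : Tendsto (fun n => energyMap 𝕜 hc Ω (u n)) atTop (𝓝 w)) :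
    ∃ hx : x ∈ Hs0 𝕜 s Ω, energyMap 𝕜 hc Ω ⟨x, hx⟩ = w := by
  obtain ⟨m, hm, hmu⟩ := (tendstoInMeasure_of_tendsto_Lp hu).exists_seq_tendsto_ae
  obtain ⟨l, hl, hlw⟩ :=
    (tendstoInMeasure_of_tendsto_Lp (hw.comp hm.tendsto_atTop)).exists_seq_tendsto_ae
  have hz := tendsto_ae_zeroExt hmu
  have hE : ∀ᵐ p : ℝ × ℝ, ∀ n,
      energyMap 𝕜 hc Ω (u n) p = weightedDiff s (zeroExt (u n).1) p :=
    ae_all_iff.2 fun n => coeFn_energyMap hc (u n)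
  have hlim : w =ᵐ[volume] weightedDiff s (zeroExt x) := by
    filter_upwards [ae_fst hz, ae_snd hz, hlw, hE] with p h1 h2 h3 h4
    simp only [Function.comp_apply, h4] at h3
    exact tendsto_nhds_unique h3
      (((h1.comp hl.tendsto_atTop).sub (h2.comp hl.tendsto_atTop)).const_mul _)
  have hx : x ∈ Hs0 𝕜 s Ω := (memHs_iff_memLp_weightedDiff hc (memLp_zeroExt x)).2
    ((memLp_congr_ae hlim).1 (Lp.memLp w))
  exact ⟨hx, Lp.ext ((coeFn_energyMap hc ⟨x, hx⟩).trans hlim.symm)⟩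

/-! ### Density of H^s_0(Ω) -/

/-- An integrable profile on `(0, ∞)` dominating the Gagliardo quotient of a bounded Lipschitz
function. -/
noncomputable def gagliardoProfile (s t : ℝ) : ℝ :=
  (Set.Ioc 0 1).indicator (fun t => t ^ (1 - 2 * s)) t +
    (Set.Ioi 1).indicator (fun t => t ^ (-(1 + 2 * s))) t

theorem gagliardoProfile_nonneg (s t : ℝ) : 0 ≤ gagliardoProfile s t :=
  add_nonneg
    (Set.indicator_nonneg (fun _ hx => Real.rpow_nonneg hx.1.le _) _)
    (Set.indicator_nonneg (fun _ hx => Real.rpow_nonneg (zero_le_one.trans (le_of_lt hx)) _) _)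

/-- Integrability at 0 needs 1 - 2s > -1, that is s < 1; at infinity it needs s > 0. -/
theorem integrable_gagliardoProfile {s : ℝ} (hs0 : 0 < s) (hs1 : s < 1) :
    Integrable (gagliardoProfile s) := by
  refine Integrable.add ?_ ?_
  · rw [integrable_indicator_iff measurableSet_Ioc, ← intervalIntegrable_iff_integrableOn_Ioc_of_le
      zero_le_one]
    exact intervalIntegral.intervalIntegrable_rpow' (by linarith)
  · rw [integrable_indicator_iff measurableSet_Ioi]
    exact integrableOn_Ioi_rpow_of_lt (by linarith) one_pos

/-- The quadratic bound on q, from the Lipschitz property, serves for t ≤ 1; the constant bound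
serves for t > 1. -/
theorem div_rpow_le_gagliardoProfile {s t A B q : ℝ} (ht : 0 < t) (hA : 0 ≤ A) (hB : 0 ≤ B)
    (hqA : q ≤ A * t ^ 2) (hqB : q ≤ B) :
    q / t ^ (1 + 2 * s) ≤ (A + B) * gagliardoProfile s t := by
  have hp := Real.rpow_pos_of_pos ht (1 + 2 * s)
  rcases le_or_gt t 1 with h | h
  · have e : gagliardoProfile s t = t ^ 2 / t ^ (1 + 2 * s) := by
      rw [gagliardoProfile, Set.indicator_of_mem (show t ∈ Set.Ioc 0 1 from ⟨ht, h⟩),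
        Set.indicator_of_notMem (show t ∉ Set.Ioi 1 from not_lt.2 h), add_zero,
        ← Real.rpow_two, ← Real.rpow_sub ht]
      ring_nf
    rw [e, mul_div_assoc']
    refine div_le_div_of_nonneg_right (hqA.trans ?_) hp.le
    nlinarith [mul_nonneg hB (sq_nonneg t)]
  · have e : gagliardoProfile s t = 1 / t ^ (1 + 2 * s) := by
      rw [gagliardoProfile, Set.indicator_of_mem (show t ∈ Set.Ioi 1 from h),
        Set.indicator_of_notMem (show t ∉ Set.Ioc 0 1 from fun h' => not_lt.2 h'.2 h), zero_add,
        Real.rpow_neg ht.le, one_div]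
    rw [e, mul_one_div]
    exact div_le_div_of_nonneg_right (by linarith) hp.le

/-- Compactly supported Lipschitz functions belong to `H^s(ℝ)`. -/
theorem memHs_of_lipschitzWith {s : ℝ} (hs0 : 0 < s) (hs1 : s < 1) {u : ℝ → 𝕜} {L : NNReal}
    (hL : LipschitzWith L u) (hcs : HasCompactSupport u) : MemHs s u := by
  have hu : MemLp u 2 volume := hL.continuous.memLp_of_hasCompactSupport hcs
  obtain ⟨M, hM⟩ := hcs.exists_bound_of_continuous hL.continuous
  have hM0 : 0 ≤ M := (norm_nonneg _).trans (hM 0)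
  set h : ℝ → ℝ := fun t => gagliardoProfile s t + gagliardoProfile s (-t) with hh
  have hhi : Integrable h :=
    (integrable_gagliardoProfile hs0 hs1).add (integrable_gagliardoProfile hs0 hs1).comp_neg
  have hh0 : ∀ t, 0 ≤ h t := fun t =>
    add_nonneg (gagliardoProfile_nonneg s _) (gagliardoProfile_nonneg s _)
  -- If u(x) ≠ u(y), one of the points lies in the support. Hence the quotient is at most a constant
  -- times (χ(x) + χ(y)) h(x - y), with h the even version of the profile; each term is an
  -- integrable convolution integrand.
  set χ : ℝ → ℝ := (tsupport u).indicator fun _ => 1 with hχ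
  have hχi : Integrable χ :=
    (integrable_indicator_iff hcs.isCompact.measurableSet).2
      (integrableOn_const hcs.isCompact.measure_lt_top.ne)
  have hχ0 : ∀ t, 0 ≤ χ t := fun t => Set.indicator_nonneg (fun _ _ => zero_le_one) t
  have i2 : Integrable (fun p : ℝ × ℝ => χ p.2 * h (p.1 - p.2)) := by
    rw [Measure.volume_eq_prod]
    exact hχi.convolution_integrand (ContinuousLinearMap.mul ℝ ℝ) hhi
  have i1 : Integrable (fun p : ℝ × ℝ => χ p.1 * h (p.2 - p.1)) := by
    rw [Measure.volume_eq_prod] at i2 ⊢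
    exact i2.swap
  refine (memHs_iff hu).2 (((i1.add i2).const_mul ((L : ℝ) ^ 2 + (2 * M) ^ 2)).mono' ?_
    (.of_forall fun p => ?_))
  · exact (((aesm_diff hu.1).norm.aemeasurable.pow_const 2).div
      (measurable_weight s).aemeasurable).aestronglyMeasurable
  · rw [Real.norm_of_nonneg (div_nonneg (sq_nonneg _) (weight_nonneg s p))]
    simp only [Pi.add_apply]
    have hsymm : h (p.2 - p.1) = h (p.1 - p.2) := by
      simp only [hh, neg_sub, add_comm]
    rw [hsymm, ← add_mul]
    by_cases h0 : u p.1 - u p.2 = 0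
    · rw [h0, norm_zero, zero_pow two_ne_zero, zero_div]
      exact mul_nonneg (by positivity)
        (mul_nonneg (add_nonneg (hχ0 _) (hχ0 _)) (hh0 _))
    · have hne : 0 < |p.1 - p.2| := by
        refine abs_pos.2 fun h1 => h0 ?_
        rw [sub_eq_zero.1 h1, sub_self]
      have hχ1 : 1 ≤ χ p.1 + χ p.2 := by
        by_cases h1 : p.1 ∈ tsupport u
        · have : χ p.1 = 1 := Set.indicator_of_mem h1 _
          linarith [hχ0 p.2]
        · by_cases h2 : p.2 ∈ tsupport u
          · have : χ p.2 = 1 := Set.indicator_of_mem h2 _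
            linarith [hχ0 p.1]
          · rw [image_eq_zero_of_notMem_tsupport h1, image_eq_zero_of_notMem_tsupport h2,
              sub_zero] at h0
            exact absurd rfl h0
      have hq1 : ‖u p.1 - u p.2‖ ^ 2 ≤ (L : ℝ) ^ 2 * |p.1 - p.2| ^ 2 := by
        rw [← mul_pow]
        exact pow_le_pow_left₀ (norm_nonneg _) (hL.norm_sub_le _ _) 2
      have hq2 : ‖u p.1 - u p.2‖ ^ 2 ≤ (2 * M) ^ 2 :=
        pow_le_pow_left₀ (norm_nonneg _)
          ((norm_sub_le _ _).trans (by linarith [hM p.1, hM p.2])) 2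
      have hprof : gagliardoProfile s |p.1 - p.2| ≤ h (p.1 - p.2) := by
        simp only [hh]
        rcases abs_cases (p.1 - p.2) with h1 | h1 <;> rw [h1.1]
        · exact le_add_of_nonneg_right (gagliardoProfile_nonneg s _)
        · exact le_add_of_nonneg_left (gagliardoProfile_nonneg s _)
      refine (div_rpow_le_gagliardoProfile hne (sq_nonneg _) (sq_nonneg _) hq1 hq2).trans ?_
      refine mul_le_mul_of_nonneg_left (hprof.trans ?_) (by positivity)
      exact le_mul_of_one_le_left (hh0 _) hχ1

/-- Smooth functions compactly supported in Ω are Lipschitz, hence in H^s_0(Ω). A function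
orthogonal to all of them vanishes almost everywhere on Ω by the fundamental lemma of the calculus
of variations. -/
theorem dense_Hs0 {s : ℝ} (hs0 : 0 < s) (hs1 : s < 1) (Ω : Opens ℝ) :
    Dense (Hs0 𝕜 s Ω : Set (L2 𝕜 Ω)) := by
  rw [Submodule.dense_iff_topologicalClosure_eq_top, Submodule.topologicalClosure_eq_top_iff,
    Submodule.eq_bot_iff]
  intro f hf
  have hΩ := Ω.isOpen.measurableSet
  have hz : ∀ᵐ x, x ∈ (Ω : Set ℝ) → zeroExt f x = 0 := by
    refine Ω.isOpen.ae_eq_zero_of_integral_contDiff_smul_eq_zero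
      (((memLp_zeroExt f).locallyIntegrable (by norm_num)).locallyIntegrableOn _)
      fun g hg hgc hgΩ => ?_
    obtain ⟨L, hL⟩ := hg.lipschitzWith_of_hasCompactSupport hgc (by simp)
    set φ : ℝ → 𝕜 := fun x => ((g x : ℝ) : 𝕜) with hφ
    have hφL : LipschitzWith L φ := LipschitzWith.of_dist_le_mul fun x y => by
      have h := hL.dist_le_mul x y
      rwa [dist_eq_norm, Real.norm_eq_abs, ← RCLike.norm_ofReal (K := 𝕜), RCLike.ofReal_sub,
        ← dist_eq_norm] at h
    have hφc : HasCompactSupport φ := hgc.comp_left RCLike.ofReal_zero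
    have hφm : MemLp φ 2 (volume.restrict (Ω : Set ℝ)) :=
      (hφL.continuous.memLp_of_hasCompactSupport hφc).restrict _
    have hφ0 : ∀ x ∉ (Ω : Set ℝ), g x = 0 := fun x hx =>
      image_eq_zero_of_notMem_tsupport fun h => hx (hgΩ h)
    have hφΩ : hφm.toLp ∈ Hs0 𝕜 s Ω := by
      refine (memHs_of_lipschitzWith hs0 hs1 hφL hφc).congr ?_
      filter_upwards [(ae_restrict_iff' hΩ).1 hφm.coeFn_toLp] with x hx
      by_cases hxΩ : x ∈ (Ω : Set ℝ)
      · rw [zeroExt, Set.indicator_of_mem hxΩ, hx hxΩ]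
      · rw [zeroExt, Set.indicator_of_notMem hxΩ, hφ]
        simp only [hφ0 x hxΩ, RCLike.ofReal_zero]
    have h := hf _ hφΩ
    rw [L2.inner_def] at h
    rw [← h, ← setIntegral_eq_integral_of_forall_compl_eq_zero (s := (Ω : Set ℝ))
      fun x hx => by rw [hφ0 x hx, zero_smul]]
    refine integral_congr_ae ?_
    filter_upwards [hφm.coeFn_toLp, ae_restrict_mem hΩ] with x hx hxΩ
    rw [hx, zeroExt, Set.indicator_of_mem hxΩ, RCLike.inner_apply, hφ, RCLike.conj_ofReal,
      RCLike.real_smul_eq_coe_mul, mul_comm]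
  refine Lp.ext (EventuallyEq.trans ?_ (Lp.coeFn_zero _ _ _).symm)
  filter_upwards [(ae_restrict_iff' hΩ).2 hz, ae_restrict_mem hΩ] with x hx hxΩ
  rw [zeroExt, Set.indicator_of_mem hxΩ] at hx
  exact hx

/-! ### The solution operator -/

theorem norm_le_energyMap {s : ℝ} (hs : 0 < s) (hc : 0 < fracConst s) {Ω : Opens ℝ}
    (hΩ : (Ω : Set ℝ) ⊆ Set.Ioo (-1) 1) (u : Hs0 𝕜 s Ω) :
    ‖u‖ ≤ Real.sqrt (fracConst s / 4 ^ (1 + 2 * s))⁻¹ * ‖energyMap 𝕜 hc Ω u‖ := by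
  have hk : 0 < fracConst s / 4 ^ (1 + 2 * s) := by positivity
  rw [← Real.sqrt_sq (norm_nonneg (energyMap 𝕜 hc Ω u)), ← Real.sqrt_mul (inv_nonneg.2 hk.le)]
  refine Real.le_sqrt_of_sq_le ?_
  rw [inv_mul_eq_div, le_div_iff₀ hk, mul_comm]
  exact norm_sq_le_energyMap hs hc hΩ u

/-- The weak problem on a subset of `(-1, 1)` is solved by an injective symmetric bounded
operator. -/
theorem exists_solutionOperator {s : ℝ} (hs0 : 0 < s) (hs1 : s < 1) {Ω : Opens ℝ}
    (hΩ : (Ω : Set ℝ) ⊆ Set.Ioo (-1) 1) :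
    ∃ S : L2 𝕜 Ω →L[𝕜] L2 𝕜 Ω, (S : L2 𝕜 Ω →ₗ[𝕜] L2 𝕜 Ω).IsSymmetric ∧ Function.Injective S ∧
      ∀ u f, u = S f ↔ IsWeakSolution s u f := by
  have hc := fracConst_pos hs0 hs1
  obtain ⟨S, h1, h2, h3⟩ := exists_symmetric_inverse_of_closed_coercive
    (dense_Hs0 (𝕜 := 𝕜) hs0 hs1 Ω)
    (energyMap 𝕜 hc Ω) (norm_le_energyMap hs0 hc hΩ) (energyMap_closed hc)
  refine ⟨S, h1, h2, fun u f => (h3 u f).trans ?_⟩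
  constructor
  · intro h
    have hu : u ∈ Hs0 𝕜 s Ω := h.fst
    refine And.intro hu fun v hv => ?_
    rw [← inner_energyMap hc ⟨u, hu⟩ ⟨v, hv⟩]
    exact h.snd ⟨v, hv⟩
  · intro h
    refine Exists.intro h.1 fun v => ?_
    rw [inner_energyMap hc ⟨u, h.1⟩ v]
    exact h.2 v v.2

/-! ### The potential as a bounded symmetric operator -/

theorem conj_stepPotential {k : ℕ} (a b V : Fin k → ℝ) (x : ℝ) :
    conj (stepPotential 𝕜 a b V x) = stepPotential 𝕜 a b V x := by
  simp only [stepPotential, map_sum]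
  refine Finset.sum_congr rfl fun i _ => ?_
  by_cases hx : x ∈ Set.Ioo (a i) (b i) <;> simp [hx]

theorem coeFn_potentialOp {k : ℕ} (a b V : Fin k → ℝ) (u : L2 𝕜 (wells a b)) :
    potentialOp 𝕜 a b V u =ᵐ[volume.restrict (wells a b : Set ℝ)]
      fun x => stepPotential 𝕜 a b V x * u x := by
  refine (ContinuousLinearMap.coeFn_holder (ContinuousLinearMap.mul 𝕜 𝕜) _ u).trans ?_
  filter_upwards [(memLp_stepPotential (𝕜 := 𝕜) a b V
    (volume.restrict (wells a b : Set ℝ))).coeFn_toLp] with x hx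
  rw [hx, ContinuousLinearMap.mul_apply']

theorem isSymmetric_potentialOp {k : ℕ} (a b V : Fin k → ℝ) :
    (potentialOp 𝕜 a b V : L2 𝕜 (wells a b) →ₗ[𝕜] L2 𝕜 (wells a b)).IsSymmetric := by
  intro u v
  change inner 𝕜 (potentialOp 𝕜 a b V u) v = inner 𝕜 u (potentialOp 𝕜 a b V v)
  rw [L2.inner_def, L2.inner_def]
  refine integral_congr_ae ?_
  filter_upwards [coeFn_potentialOp a b V u, coeFn_potentialOp a b V v] with x hu hv
  rw [hu, hv, RCLike.inner_apply, RCLike.inner_apply, map_mul, conj_stepPotential]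
  ring

theorem wells_subset {k : ℕ} {a b : Fin k → ℝ}
    (hab : ∀ i, -1 ≤ a i ∧ a i < b i ∧ b i ≤ 1) : (wells a b : Set ℝ) ⊆ Set.Ioo (-1) 1 :=
  Set.iUnion_subset fun i => Set.Ioo_subset_Ioo (hab i).1 (hab i).2.2

end FracLap

/-! ### Self-adjointness of the operator and its perturbations -/

theorem mainTheorem7 {𝕜 : Type*} [RCLike 𝕜] (s : ℝ) (hs0 : 0 < s) (hs1 : s < 1)
    (k : ℕ) (a b : Fin k → ℝ)
    (hab : ∀ i, -1 ≤ a i ∧ a i < b i ∧ b i ≤ 1)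
    (hdisj : Pairwise fun i j => Disjoint (Set.Ioo (a i) (b i)) (Set.Ioo (a j) (b j))) :
    -- the operator is well defined by the weak formulation, and bijective onto `L²(Ω)`
    ((∀ u f : FracLap.L2 𝕜 (FracLap.wells a b),
        (u, f) ∈ (FracLap.restrictedFracLaplacian 𝕜 s (FracLap.wells a b)).graph ↔
          FracLap.IsWeakSolution s u f) ∧
      Function.Bijective (FracLap.restrictedFracLaplacian 𝕜 s (FracLap.wells a b)) ∧
      -- densely defined, closed, symmetric and self-adjoint
      Dense ((FracLap.restrictedFracLaplacian 𝕜 s (FracLap.wells a b)).domain :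
        Set (FracLap.L2 𝕜 (FracLap.wells a b))) ∧
      (FracLap.restrictedFracLaplacian 𝕜 s (FracLap.wells a b)).IsClosed ∧
      (FracLap.restrictedFracLaplacian 𝕜 s (FracLap.wells a b)).IsFormalAdjoint
        (FracLap.restrictedFracLaplacian 𝕜 s (FracLap.wells a b)) ∧
      IsSelfAdjoint (FracLap.restrictedFracLaplacian 𝕜 s (FracLap.wells a b))) ∧
    -- the perturbed operator is closed and self-adjoint
    ∀ (V : Fin k → ℝ) (ε : ℝ), 0 < ε →
      (FracLap.perturbedFracLaplacian 𝕜 s a b V ε).IsClosed ∧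
      IsSelfAdjoint (FracLap.perturbedFracLaplacian 𝕜 s a b V ε) := by
  obtain ⟨S, hS, hinj, hSw⟩ :=
    FracLap.exists_solutionOperator (𝕜 := 𝕜) hs0 hs1 (FracLap.wells_subset hab)
  have hgraph : ∀ u f : FracLap.L2 𝕜 (FracLap.wells a b),
      (u, f) ∈ (FracLap.restrictedFracLaplacian 𝕜 s (FracLap.wells a b)).graph ↔
        FracLap.IsWeakSolution s u f := fun u f => by
    rw [FracLap.restrictedFracLaplacian, Submodule.toLinearPMap_graph_eq]
    · rfl
    -- Single-valuedness, which `Submodule.toLinearPMap` needs in order to have the given graph: x =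
    -- 0 gives Sg = 0, so g = 0.
    · rintro ⟨x, g⟩ hx hx0
      have h : x = S g := (hSw x g).2 hx
      exact hinj (h.symm.trans (Eq.trans hx0 S.map_zero.symm))
  obtain ⟨hbij, hsymm, hsa⟩ := LinearPMap.isSelfAdjoint_of_graph_iff hS hinj
    fun u f => (hgraph u f).trans (hSw u f).symm
  refine ⟨⟨hgraph, hbij, hsa.dense_domain, hsa.isClosed, hsymm, hsa⟩, fun V ε _ => ?_⟩
  have hP : IsSelfAdjoint (FracLap.perturbedFracLaplacian 𝕜 s a b V ε) := by
    refine hsa.vadd_continuousLinearMap (B := (ε : 𝕜) • FracLap.potentialOp 𝕜 a b V)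
      fun u v => ?_
    change inner 𝕜 ((ε : 𝕜) • FracLap.potentialOp 𝕜 a b V u) v =
      inner 𝕜 u ((ε : 𝕜) • FracLap.potentialOp 𝕜 a b V v)
    rw [inner_smul_left, inner_smul_right, RCLike.conj_ofReal]
    exact congrArg _ (FracLap.isSymmetric_potentialOp a b V u v)
  exact ⟨hP.isClosed, hP⟩
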